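/- Let $\mathcal G=(\{1,\dots,N\},E)$ be a connected undirected graph with Laplacian $L$, and let $N_i$ be the set of neighbours of $i$. For $i=1,\dots,N$ and $m=1,\dots,M$ let $a_i^m\in\mathbb R^{d_i}$, $b_i^m\in\mathbb R$, and let $f_i:\mathbb R^{d_i}\to\mathbb R$ be convex. Consider the coupled problem $$\min_{x_1,\dots,x_N}\ \sum_{i} f_i(x_i)\quad\text{s.t.}\quad \sum_{i}\big(a_i^{m\top}x_i+b_i^m\big)\le 0,\quad m=1,\dots,M, \tag{C}$$ the reformulated problem with additional variables $y=(y_i^m)\in\mathbb R^{NM}$, $y^m=(y_1^m,\dots,y_N^m)$, $$\min_{x,y}\ \sum_{i} f_i(x_i)\quad\text{s.t.}\quad a_i^{m\top}x_i+(Ly^m)_i+b_i^m\le 0\quad\text{for all } i,m, \tag{R}$$ and, for a given $y$, the local problems $$\min_{x_i}\ f_i(x_i)\quad\text{s.t.}\quad a_i^{m\top}x_i+\sum_{j\in N_i}(y_i^m-y_j^m)+b_i^m\le 0,\quad m=1,\dots,M. \tag{$\mathrm{P}_i(y)$}$$ A Lagrange multiplier of $(\mathrm P_i(y))$ is a vector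 $c_i\in\mathbb R^M$, $c_i\ge 0$, for which the infimum of the Lagrangian over $x_i\in\mathbb R^{d_i}$ equals the optimal value of $(\mathrm P_i(y))$. Assume that the optimal value $p$ of (C) is finite and that for every $y\in\mathbb R^{NM}$ and every $i$ there is an $x_i$ that is strictly feasible for $(\mathrm P_i(y))$. Let $k_0>0$ and let $y:[0,\infty)\to\mathbb R^{NM}$ be a Carathéodory solution of $$\dot y_i=-k_0\sum_{j\in N_i}(c_i-c_j),$$ that is, $y$ is locally absolutely continuous and, for almost every $t\ge 0$, the equation holds at $t$ for some Lagrange multipliers $c_i$ of $(\mathrm P_i(y(t)))$, where $y_i=(y_i^1,\dots,y_i^M)$. Then: 1. Every Carathéodory solution with the initial value $y(0)$ coincides with $y$ on $[0,\infty)$. If the set of those $y$ for which the infimum over $x$ in (R), with $y$ held fixed, equals the optimal value of (R) is non-empty, then the distance of $y(t)$ to it tends to $0$ as $t\to\infty$. If (C) has an optimal solution and every local problem $(\mathrm P_i(w))$, $w\in\mathbb R^{NM}$, has an optimal solution, then the set of those $y$ for which some $(x,y)$ is an optimal solution of (R) is non-empty and the distance of $y(t)$ to it tends to $0$. 2. Let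 $x(t)=(x_1(t),\dots,x_N(t))$, where $x_i(t)$ is an optimal solution of $(\mathrm P_i(y(t)))$ for every $t\ge0$ and $i$. Then $\sum_i f_i(x_i(t))\to p$, and every cluster point of $x(t)$ as $t\to\infty$ is an optimal solution of (C). Suppose moreover that (C) has an optimal solution. If every local problem $(\mathrm P_i(w))$, $w\in\mathbb R^{NM}$, has a bounded set of optimal solutions, then the distance of $x(t)$ to the set of optimal solutions of (C) tends to $0$. If every local problem $(\mathrm P_i(w))$ has at most one optimal solution, then $x(t)$ converges to an optimal solution of (C). 3. For every $t\ge0$, if $x_i$ is feasible for $(\mathrm P_i(y(t)))$ for all $i$ (in particular if each $x_i$ is optimal there), then $(x_1,\dots,x_N)$ satisfies the coupling constraints of (C). -/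

import Mathlib

open Set Filter Topology MeasureTheory

/-- Data of a constraint-coupled problem with `N` agents and `M` linear coupling constraints:
`min ∑ i, f i (x i)` subject to `∑ i, (⟪a i m, x i⟫ + b i m) ≤ 0` for every `m`. -/
structure CoupledProblem (N M : ℕ) where
  /-- dimension of the decision variable of each agent -/
  d : Fin N → ℕ
  /-- local costs -/
  f : (i : Fin N) → EuclideanSpace ℝ (Fin (d i)) → ℝ
  /-- constraint vectors -/
  a : (i : Fin N) → Fin M → EuclideanSpace ℝ (Fin (d i))
  /-- constraint offsets -/
  b : Fin N → Fin M → ℝ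

/-- Auxiliary variables: the entry at `(i, m)` belongs to agent `i` and constraint `m`. -/
abbrev AuxSpace (N M : ℕ) : Type := EuclideanSpace ℝ (Fin N × Fin M)

namespace CoupledProblem

variable {N M : ℕ} (P : CoupledProblem N M) (G : SimpleGraph (Fin N)) [DecidableRel G.Adj]

/-- Decision variable of agent `i`. -/
abbrev Local (i : Fin N) : Type := EuclideanSpace ℝ (Fin (P.d i))

/-- Stacked decision variable. -/
abbrev Primal : Type := (i : Fin N) → P.Local i

/-- Total cost. -/
noncomputable def cost (x : P.Primal) : ℝ := ∑ i, P.f i (x i)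

/-! ### The coupled (centralized) problem -/

/-- The coupling constraints. -/
def Feasible (x : P.Primal) : Prop :=
  ∀ m, ∑ i, (inner ℝ (P.a i m) (x i) + P.b i m) ≤ 0

/-- `p` is the (finite) optimal value of the coupled problem. -/
def IsOptimalValue (p : ℝ) : Prop := IsGLB (P.cost '' {x | P.Feasible x}) p

/-- `x` is an optimal solution of the coupled problem. -/
def IsOptimal (x : P.Primal) : Prop :=
  P.Feasible x ∧ ∀ x', P.Feasible x' → P.cost x ≤ P.cost x'

/-! ### The reformulated problem in `(x, y)` -/

/-- Constraints of the reformulated problem, written with the graph Laplacian `L`: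
`⟪a i m, x i⟫ + (L yᵐ) i + b i m ≤ 0` for all `i` and `m`. -/
def ReformulatedFeasible (x : P.Primal) (y : AuxSpace N M) : Prop :=
  ∀ m i, inner ℝ (P.a i m) (x i) + ((G.lapMatrix ℝ).mulVec (fun j => y (j, m))) i + P.b i m ≤ 0

/-- `(x, y)` is an optimal solution of the reformulated problem. -/
def IsReformulatedOptimal (x : P.Primal) (y : AuxSpace N M) : Prop :=
  P.ReformulatedFeasible G x y ∧
    ∀ x' y', P.ReformulatedFeasible G x' y' → P.cost x ≤ P.cost x'

/-- The set of optimal `y` of the reformulated problem. -/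
def optimalAux : Set (AuxSpace N M) := {y | ∃ x, P.IsReformulatedOptimal G x y}

/-- The set of `y` at which the infimum over `x` of the reformulated problem with `y` held fixed
equals the optimal value of the reformulated problem (no minimum over `x` has to be attained). -/
def valueOptimalAux : Set (AuxSpace N M) :=
  {y | ∃ v : ℝ, IsGLB (P.cost '' {x | P.ReformulatedFeasible G x y}) v ∧
    ∀ x' y', P.ReformulatedFeasible G x' y' → v ≤ P.cost x'}

/-! ### The local problems, for a fixed `y` -/

/-- Left-hand side of the `m`-th constraint of the local problem of agent `i`. -/
noncomputable def localConstraint (i : Fin N) (y : AuxSpace N M) (m : Fin M) (x : P.Local i) : ℝ :=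
  inner ℝ (P.a i m) x + ∑ j ∈ G.neighborFinset i, (y (i, m) - y (j, m)) + P.b i m

/-- Feasibility for the local problem. -/
def LocalFeasible (i : Fin N) (y : AuxSpace N M) (x : P.Local i) : Prop :=
  ∀ m, P.localConstraint G i y m x ≤ 0

/-- `x` is an optimal solution of the local problem of agent `i`. -/
def IsLocalOptimal (i : Fin N) (y : AuxSpace N M) (x : P.Local i) : Prop :=
  P.LocalFeasible G i y x ∧ ∀ x', P.LocalFeasible G i y x' → P.f i x ≤ P.f i x'

/-- Slater's condition for all local problems, for every `y`. -/
def LocalSlater : Prop :=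
  ∀ (y : AuxSpace N M) (i : Fin N), ∃ x : P.Local i, ∀ m, P.localConstraint G i y m x < 0

/-- `c` is a Lagrange multiplier of the local problem of agent `i`: `c ≥ 0`, and the infimum of the
Lagrangian over all `x` equals the optimal value of the local problem. -/
def IsLagrangeMultiplier (i : Fin N) (y : AuxSpace N M) (c : Fin M → ℝ) : Prop :=
  (∀ m, 0 ≤ c m) ∧
    ∃ v : ℝ, IsGLB (P.f i '' {x | P.LocalFeasible G i y x}) v ∧
      IsGLB (range fun x : P.Local i => P.f i x + ∑ m, c m * P.localConstraint G i y m x) v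

/-- Right-hand side of the update law, with entries `-k₀ ∑_{j ∈ N_i} (c i m - c j m)`. -/
noncomputable def updateLaw (k₀ : ℝ) (c : Fin N → Fin M → ℝ) : AuxSpace N M :=
  WithLp.toLp 2 fun q => -k₀ * ∑ j ∈ G.neighborFinset q.1, (c q.1 q.2 - c j q.2)

/-- `y : [0, ∞) → ℝ^{NM}` is a Carathéodory solution of the update law: it is (locally) absolutely
continuous and, for almost every `t ≥ 0`, `ẏ(t)` is the right-hand side of the law for some Lagrange
multipliers of the local problems given `y(t)`. Any rule for choosing the multipliers is allowed.
Values of `y` at negative times are irrelevant. -/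
def IsCaratheodorySolution (k₀ : ℝ) (y : ℝ → AuxSpace N M) : Prop :=
  (∀ T : ℝ, 0 < T → AbsolutelyContinuousOnInterval y 0 T) ∧
    ∀ᵐ t ∂(volume.restrict (Ici (0 : ℝ))), ∃ c : Fin N → Fin M → ℝ,
      (∀ i, P.IsLagrangeMultiplier G i (y t) (c i)) ∧ HasDerivAt y (updateLaw G k₀ c) t

end CoupledProblem

/-!
Let `V i y` be the optimal value of the local problem of agent `i` (`CoupledProblem.localValue`) and
`φ y = ∑ i, V i y` (`CoupledProblem.value`). Summing the local constraints cancels the auxiliary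
variables, and for a connected graph the range of the Laplacian `L` is the orthogonal complement of
the constants, so every feasible point of the coupled problem is locally feasible for suitable
auxiliary variables. Hence `inf φ = p` (`CoupledProblem.isGLB_range_value`), and in particular all
the local values are finite. Each `V i` is a convex function on a finite-dimensional space, so `φ`
is locally Lipschitz.

Strong duality at `y` and weak duality at `w` turn multipliers `c` of the local problems into a
subgradient `L c` of `φ` at `y` (`CoupledProblem.value_add_inner_le`). The update law therefore is
the subgradient flow `ẏ ∈ -k₀ ∂φ(y)`. For such a flow monotonicity of `∂φ` gives contraction
(`IsSubgradientFlow.norm_sub_le`) and with it uniqueness; an energy argument gives `φ (y t) → inf φ`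
(`IsSubgradientFlow.tendsto_comp`); and if minimizers exist, then `y t` converges to one of them
(`IsSubgradientFlow.exists_tendsto`). All of this rests on one fact: an absolutely continuous
function with almost everywhere nonpositive derivative does not increase.

Solutions `x t` of the local problems satisfy `∑ i, f i (x t i) = φ (y t) → p` and the coupling
constraints, so their cluster points are optimal. What is left is boundedness of `x t`. The local
problem at the limit of `y t` need not have a solution, but the one at time `0` has, and its
solution set is bounded. A convex function with one nonempty bounded sublevel set has only bounded
ones (`ConvexOn.isBounded_sublevel`), and this bounds the level sets of all local problems of an
agent at once (`CoupledProblem.exists_isCompact_eventually_mem`).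
-/

/-! ### Absolutely continuous functions -/

theorem LipschitzOnWith.comp_absolutelyContinuousOnInterval {X Y : Type*} [PseudoMetricSpace X]
    [PseudoMetricSpace Y] {f : X → Y} {g : ℝ → X} {K : NNReal} {s : Set X} {a b : ℝ}
    (hf : LipschitzOnWith K f s) (hg : AbsolutelyContinuousOnInterval g a b)
    (hs : MapsTo g (uIcc a b) s) : AbsolutelyContinuousOnInterval (f ∘ g) a b := by
  rw [absolutelyContinuousOnInterval_iff] at hg ⊢
  intro ε hε
  obtain ⟨δ, hδ, h⟩ := hg (ε / (K + 1)) (by positivity)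
  refine ⟨δ, hδ, fun I hI hlt => ?_⟩
  calc ∑ i ∈ Finset.range I.1, dist (f (g (I.2 i).1)) (f (g (I.2 i).2))
      ≤ ∑ i ∈ Finset.range I.1, (K + 1) * dist (g (I.2 i).1) (g (I.2 i).2) := by
        refine Finset.sum_le_sum fun i hi => ?_
        have hi' := hI.1 i hi
        refine (hf.dist_le_mul _ (hs hi'.1) _ (hs hi'.2)).trans ?_
        gcongr
        linarith
    _ = (K + 1) * ∑ i ∈ Finset.range I.1, dist (g (I.2 i).1) (g (I.2 i).2) := by
        rw [Finset.mul_sum]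
    _ < (K + 1) * (ε / (K + 1)) := by
        have := h I hI hlt
        gcongr
    _ = ε := by field_simp

theorem LocallyLipschitz.comp_absolutelyContinuousOnInterval {X Y : Type*}
    [SeminormedAddCommGroup X] [PseudoMetricSpace Y] {f : X → Y} {g : ℝ → X} {a b : ℝ}
    (hf : LocallyLipschitz f) (hg : AbsolutelyContinuousOnInterval g a b) :
    AbsolutelyContinuousOnInterval (f ∘ g) a b := by
  obtain ⟨K, hK⟩ := LocallyLipschitzOn.exists_lipschitzOnWith_of_compact
    (isCompact_uIcc.image_of_continuousOn hg.continuousOn) hf.locallyLipschitzOn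
  exact hK.comp_absolutelyContinuousOnInterval hg (mapsTo_image g _)

theorem AbsolutelyContinuousOnInterval.le_of_ae_deriv_nonpos {h : ℝ → ℝ} {a b : ℝ} (hab : a ≤ b)
    (hh : AbsolutelyContinuousOnInterval h a b)
    (hd : ∀ᵐ t, t ∈ Icc a b → deriv h t ≤ 0) : h b ≤ h a := by
  have h1 : 0 ≤ ∫ t in a..b, -deriv h t := by
    refine intervalIntegral.integral_nonneg_of_ae_restrict hab ?_
    rw [EventuallyLE, ae_restrict_iff' measurableSet_Icc]
    filter_upwards [hd] with t ht hmem
    simpa using ht hmem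
  rw [intervalIntegral.integral_neg, hh.integral_deriv_eq_sub] at h1
  linarith

theorem AbsolutelyContinuousOnInterval.norm_sq {E : Type*} [SeminormedAddCommGroup E] {g : ℝ → E}
    {a b : ℝ} (hg : AbsolutelyContinuousOnInterval g a b) :
    AbsolutelyContinuousOnInterval (fun t => ‖g t‖ ^ 2) a b := by
  have h := (lipschitzWith_one_norm.lipschitzOnWith (s := univ)).comp_absolutelyContinuousOnInterval
    hg (mapsTo_univ _ _)
  simpa only [sq, Function.comp_def] using h.fun_mul h

/-! ### Cluster points of bounded curves -/

theorem MapClusterPt.eq_of_tendsto {ι X : Type*} [TopologicalSpace X] [T2Space X] {l : Filter ι}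
    {u : ι → X} {x y : X} (h : MapClusterPt x l u) (h' : Tendsto u l (𝓝 y)) : x = y :=
  eq_of_nhds_neBot (NeBot.mono h (inf_le_inf_left _ h'))

/-- A function that stays in a compact set approaches every set containing its cluster points. -/
theorem Metric.tendsto_infDist_of_mapClusterPt {ι X : Type*} [PseudoMetricSpace X] {l : Filter ι}
    {u : ι → X} {K S : Set X} (hK : IsCompact K) (hu : ∀ᶠ t in l, u t ∈ K)
    (hS : ∀ x, MapClusterPt x l u → x ∈ S) : Tendsto (fun t => Metric.infDist (u t) S) l (𝓝 0) := by
  rw [Metric.tendsto_nhds]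
  intro ε hε
  by_contra hcon
  rw [not_eventually] at hcon
  have : NeBot (l ⊓ 𝓟 {t | ¬ dist (Metric.infDist (u t) S) 0 < ε}) :=
    frequently_mem_iff_neBot.1 hcon
  obtain ⟨x, -, hx⟩ := hK.exists_mapClusterPt
    (f := l ⊓ 𝓟 {t | ¬ dist (Metric.infDist (u t) S) 0 < ε}) (u := u)
    (le_principal_iff.2 (hu.filter_mono inf_le_left))
  have hxS := hS x (hx.mono (Filter.map_mono inf_le_left))
  obtain ⟨t, ht, ht'⟩ := ((hx.frequently (Metric.ball_mem_nhds x hε)).and_eventually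
    (mem_inf_of_right (mem_principal_self _))).exists
  refine ht' ?_
  rw [Real.dist_0_eq_abs, abs_of_nonneg Metric.infDist_nonneg]
  exact (Metric.infDist_le_dist_of_mem hxS).trans_lt ht

/-! ### Subgradient flows -/

section SubgradientFlow

variable {E : Type*} [NormedAddCommGroup E] [InnerProductSpace ℝ E]

/-- `y : [0, ∞) → E` is a Carathéodory solution of the differential inclusion `ẏ ∈ -k ∂φ(y)`,
where `∂φ` is the subdifferential in the sense of convex analysis. -/
def IsSubgradientFlow (φ : E → ℝ) (k : ℝ) (y : ℝ → E) : Prop :=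
  (∀ T : ℝ, 0 < T → AbsolutelyContinuousOnInterval y 0 T) ∧
    ∀ᵐ t ∂(volume.restrict (Ici (0 : ℝ))), ∃ g : E,
      (∀ w, φ (y t) + inner ℝ g (w - y t) ≤ φ w) ∧ HasDerivAt y (-(k • g)) t

namespace IsSubgradientFlow

variable {φ : E → ℝ} {k : ℝ} {y z : ℝ → E}

theorem absolutelyContinuousOnInterval (hy : IsSubgradientFlow φ k y) {s t : ℝ} (hs : 0 ≤ s)
    (hst : s ≤ t) : AbsolutelyContinuousOnInterval y s t := by
  refine (hy.1 (t + 1) (by linarith)).mono ?_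
  rw [uIcc_of_le hst, uIcc_of_le (by linarith)]
  exact Icc_subset_Icc hs (by linarith)

/-- The subdifferential is monotone, so two trajectories never move apart. -/
theorem norm_sub_le (hk : 0 ≤ k) (hy : IsSubgradientFlow φ k y) (hz : IsSubgradientFlow φ k z)
    {s t : ℝ} (hs : 0 ≤ s) (hst : s ≤ t) : ‖y t - z t‖ ≤ ‖y s - z s‖ := by
  have hac := ((hy.absolutelyContinuousOnInterval hs hst).fun_sub
    (hz.absolutelyContinuousOnInterval hs hst)).norm_sq
  have h := hac.le_of_ae_deriv_nonpos hst ?_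
  · exact (sq_le_sq₀ (norm_nonneg _) (norm_nonneg _)).1 h
  · have h1 := (ae_restrict_iff' measurableSet_Ici).1 hy.2
    have h2 := (ae_restrict_iff' measurableSet_Ici).1 hz.2
    filter_upwards [h1, h2] with r hr1 hr2 hr
    obtain ⟨g, hg, hyd⟩ := hr1 (hs.trans hr.1)
    obtain ⟨g', hg', hzd⟩ := hr2 (hs.trans hr.1)
    rw [(hyd.fun_sub hzd).norm_sq.deriv]
    have e1 := hg (z r)
    have e2 := hg' (y r)
    have e3 : inner ℝ g (z r - y r) = - inner ℝ (y r - z r) g := by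
      rw [real_inner_comm, ← inner_neg_left, neg_sub]
    rw [real_inner_comm] at e2
    have e4 : inner ℝ (y r - z r) (-(k • g) - -(k • g')) =
        -k * (inner ℝ (y r - z r) g - inner ℝ (y r - z r) g') := by
      simp only [inner_sub_right, inner_neg_right, real_inner_smul_right]
      ring
    rw [e4]
    have : 0 ≤ inner ℝ (y r - z r) g - inner ℝ (y r - z r) g' := by linarith
    nlinarith

theorem eq_of_eq_zero (hk : 0 ≤ k) (hy : IsSubgradientFlow φ k y) (hz : IsSubgradientFlow φ k z)
    (h0 : y 0 = z 0) {t : ℝ} (ht : 0 ≤ t) : y t = z t := by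
  have := hy.norm_sub_le hk hz le_rfl ht
  rw [h0, sub_self, norm_zero] at this
  exact sub_eq_zero.1 (norm_le_zero_iff.1 this)

/-- A minimizer is an equilibrium of the flow. -/
theorem const {w : E} (hw : ∀ v, φ w ≤ φ v) : IsSubgradientFlow φ k fun _ => w := by
  refine ⟨fun T _ => ?_,
    .of_forall fun t => ⟨0, by simpa using hw, by simpa using hasDerivAt_const t w⟩⟩
  exact (LipschitzWith.const w).lipschitzOnWith.absolutelyContinuousOnInterval

/-- The chain rule along the flow: wherever `φ ∘ y` is differentiable its derivative is
`⟪g, ẏ⟫ = -k ‖g‖²`, since `φ ∘ y - ⟪g, y⟫` has a minimum there. -/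
theorem ae_deriv_comp_nonpos (hk : 0 ≤ k) (hφ : LocallyLipschitz φ) (hy : IsSubgradientFlow φ k y)
    {s t : ℝ} (hs : 0 ≤ s) (hst : s ≤ t) :
    ∀ᵐ r, r ∈ Icc s t → DifferentiableAt ℝ (φ ∘ y) r ∧ deriv (φ ∘ y) r ≤ 0 := by
  have hac := hφ.comp_absolutelyContinuousOnInterval (hy.absolutelyContinuousOnInterval hs hst)
  filter_upwards [(ae_restrict_iff' measurableSet_Ici).1 hy.2, hac.ae_differentiableAt]
    with r hr hdiff hmem
  obtain ⟨g, hg, hyd⟩ := hr (hs.trans hmem.1)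
  have hd := hdiff (by rwa [uIcc_of_le hst])
  refine ⟨hd, ?_⟩
  have hmin : IsLocalMin (fun u => (φ ∘ y) u - inner ℝ g (y u)) r := by
    refine .of_forall fun u => ?_
    have := hg (y u)
    rw [inner_sub_right] at this
    simp only [Function.comp_apply]
    linarith
  have h0 := hmin.hasDerivAt_eq_zero
    (hd.hasDerivAt.sub ((hasDerivAt_const r g).inner ℝ hyd))
  simp only [inner_zero_left, add_zero, inner_neg_right, real_inner_smul_right,
    real_inner_self_eq_norm_sq] at h0
  have : 0 ≤ k * ‖g‖ ^ 2 := by positivity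
  linarith

/-- The rate `O(1 / t)` at which the values along the flow fall to those at any other point: the
energy `‖y t - w‖² + 2 k t (φ (y t) - φ w)` is nonincreasing. -/
theorem mul_sub_le (hk : 0 ≤ k) (hφ : LocallyLipschitz φ) (hy : IsSubgradientFlow φ k y) (w : E)
    {t : ℝ} (ht : 0 ≤ t) : 2 * k * t * (φ (y t) - φ w) ≤ ‖y 0 - w‖ ^ 2 := by
  have hac := hy.absolutelyContinuousOnInterval le_rfl ht
  have hw : AbsolutelyContinuousOnInterval (fun _ : ℝ => w) 0 t :=
    (LipschitzWith.const w).lipschitzOnWith.absolutelyContinuousOnInterval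
  have hφw : AbsolutelyContinuousOnInterval (fun _ : ℝ => φ w) 0 t :=
    (LipschitzWith.const (φ w)).lipschitzOnWith.absolutelyContinuousOnInterval
  have hid : AbsolutelyContinuousOnInterval (fun r : ℝ => r) 0 t :=
    LipschitzWith.id.lipschitzOnWith.absolutelyContinuousOnInterval
  have hac1 := (hac.fun_sub hw).norm_sq
  have hac2 := (hid.const_mul (2 * k)).fun_mul
    ((hφ.comp_absolutelyContinuousOnInterval hac).fun_sub hφw)
  have h := (hac1.fun_add hac2).le_of_ae_deriv_nonpos ht ?_
  · simp only [Function.comp_apply, mul_zero, zero_mul, add_zero] at h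
    nlinarith [sq_nonneg ‖y t - w‖]
  · filter_upwards [(ae_restrict_iff' measurableSet_Ici).1 hy.2,
      hy.ae_deriv_comp_nonpos hk hφ le_rfl ht] with r hr hdr hmem
    obtain ⟨g, hg, hyd⟩ := hr hmem.1
    obtain ⟨hd, hle⟩ := hdr hmem
    have D1 := (hyd.sub_const w).norm_sq
    have D2 := ((hasDerivAt_id' r).const_mul (2 * k)).fun_mul (hd.hasDerivAt.sub_const (φ w))
    have e := (D1.fun_add D2).deriv
    rw [e]
    have e1 := hg w
    have e3 : inner ℝ g (w - y r) = - inner ℝ (y r - w) g := by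
      rw [real_inner_comm, ← inner_neg_left, neg_sub]
    simp only [inner_neg_right, real_inner_smul_right, Function.comp_apply]
    have h1 : 0 ≤ k * r := mul_nonneg hk hmem.1
    nlinarith [mul_nonneg h1 (neg_nonneg.2 hle)]

/-- Along the flow `φ` tends to its infimum, whether or not the infimum is attained. -/
theorem tendsto_comp (hk : 0 < k) (hφ : LocallyLipschitz φ) (hy : IsSubgradientFlow φ k y) {p : ℝ}
    (hp : IsGLB (range φ) p) : Tendsto (fun t => φ (y t)) atTop (𝓝 p) := by
  rw [Metric.tendsto_atTop]
  intro ε hε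
  obtain ⟨-, ⟨w, rfl⟩, -, hw⟩ := hp.exists_between (show p < p + ε / 2 by linarith)
  refine ⟨‖y 0 - w‖ ^ 2 / (k * ε) + 1, fun t ht => ?_⟩
  have hpos : 0 ≤ ‖y 0 - w‖ ^ 2 / (k * ε) := by positivity
  have h1 := hy.mul_sub_le hk.le hφ w (t := t) (by linarith)
  have h2 : ‖y 0 - w‖ ^ 2 < t * (k * ε) := by
    rw [← div_lt_iff₀ (by positivity)]
    linarith
  have h3 : φ (y t) - φ w < ε / 2 := by
    by_contra! h
    have : 2 * k * t * (ε / 2) ≤ 2 * k * t * (φ (y t) - φ w) := by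
      have : 0 ≤ t := by linarith
      gcongr
    nlinarith
  have h4 := hp.1 ⟨y t, rfl⟩
  rw [Real.dist_eq, abs_of_nonneg (by linarith)]
  linarith

/-- Bruck's theorem in finite dimension: a subgradient flow converges to a minimizer, if there is
one. A minimizer keeps the trajectory bounded, any cluster point is a minimizer, and the distance
to that cluster point is nonincreasing. -/
theorem exists_tendsto [FiniteDimensional ℝ E] (hk : 0 < k) (hφ : LocallyLipschitz φ)
    (hy : IsSubgradientFlow φ k y) {w : E} (hw : ∀ v, φ w ≤ φ v) :
    ∃ w', (∀ v, φ w' ≤ φ v) ∧ Tendsto y atTop (𝓝 w') := by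
  have hp : IsGLB (range φ) (φ w) :=
    ⟨by rintro - ⟨v, rfl⟩; exact hw v, fun b hb => hb ⟨w, rfl⟩⟩
  have hball : ∀ t, 0 ≤ t → y t ∈ Metric.closedBall w ‖y 0 - w‖ := fun t ht => by
    rw [Metric.mem_closedBall, dist_eq_norm]
    exact hy.norm_sub_le hk.le (const hw) le_rfl ht
  obtain ⟨w', -, hw'⟩ := (isCompact_closedBall w ‖y 0 - w‖).exists_mapClusterPt
    (f := atTop) (u := y) (le_principal_iff.2 (eventually_atTop.2 ⟨0, hball⟩))
  have hval : φ w' = φ w :=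
    (hw'.continuousAt_comp hφ.continuous.continuousAt).eq_of_tendsto (hy.tendsto_comp hk hφ hp)
  have hmin : ∀ v, φ w' ≤ φ v := fun v => hval.le.trans (hw v)
  refine ⟨w', hmin, ?_⟩
  rw [Metric.tendsto_atTop]
  intro ε hε
  obtain ⟨s, hs, hs0⟩ := ((hw'.frequently (Metric.ball_mem_nhds w' hε)).and_eventually
    (eventually_ge_atTop 0)).exists
  refine ⟨s, fun t ht => ?_⟩
  rw [dist_eq_norm] at hs ⊢
  exact (hy.norm_sub_le hk.le (const hmin) hs0 ht).trans_lt hs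

end IsSubgradientFlow

end SubgradientFlow

/-! ### Sublevel sets of convex functions -/

/-- If one nonempty sublevel set of a convex function is bounded, then so are all sublevel sets:
outside a large sphere the function grows at least linearly. -/
theorem ConvexOn.isBounded_sublevel {E : Type*} [NormedAddCommGroup E] [NormedSpace ℝ E]
    [FiniteDimensional ℝ E] {h : E → ℝ} (hh : ConvexOn ℝ univ h) {x₀ : E}
    {a : ℝ} (hx₀ : h x₀ ≤ a) (hb : Bornology.IsBounded {x | h x ≤ a}) (b : ℝ) :
    Bornology.IsBounded {x | h x ≤ b} := by
  have hc : Continuous h := hh.locallyLipschitz.continuous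
  obtain ⟨R, hR0, hR⟩ := hb.subset_ball_lt 0 x₀
  -- `a + ε` is a lower bound of `h` on the sphere of radius `R`
  obtain ⟨ε, hε, hsph⟩ : ∃ ε > 0, ∀ x ∈ Metric.sphere x₀ R, a + ε ≤ h x := by
    rcases (Metric.sphere x₀ R).eq_empty_or_nonempty with he | hne
    · exact ⟨1, one_pos, by simp [he]⟩
    · obtain ⟨z, hz, hmin⟩ := (isCompact_sphere x₀ R).exists_isMinOn hne hc.continuousOn
      refine ⟨h z - a, ?_, fun x hx => by have := hmin hx; simp at this; linarith⟩
      by_contra! hle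
      have := hR (show h z ≤ a by linarith)
      rw [Metric.mem_ball, Metric.mem_sphere.1 hz] at this
      exact this.false
  -- beyond this radius, convexity on the segment from `x₀` to `x` contradicts the bound where the
  -- segment crosses the sphere
  refine (Metric.isBounded_closedBall (x := x₀) (r := R * (1 + |b - a| / ε))).subset fun x hx => ?_
  rw [Metric.mem_closedBall, dist_eq_norm]
  by_contra! hlt
  have hnn : 0 ≤ |b - a| / ε := by positivity
  have hρ : R < ‖x - x₀‖ := by nlinarith
  have hρ0 : 0 < ‖x - x₀‖ := hR0.trans hρ
  set l := R / ‖x - x₀‖ with hl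
  have hl0 : 0 < l := by positivity
  have hl1 : l < 1 := by rw [hl, div_lt_one hρ0]; exact hρ
  have hz := hsph ((1 - l) • x₀ + l • x) (by
    rw [Metric.mem_sphere, dist_eq_norm,
      show (1 - l) • x₀ + l • x - x₀ = l • (x - x₀) by module, norm_smul, Real.norm_of_nonneg hl0.le,
      hl, div_mul_cancel₀ _ hρ0.ne'])
  have hcv := hh.2 (mem_univ x₀) (mem_univ x) (sub_nonneg.2 hl1.le) hl0.le (by ring)
  simp only [smul_eq_mul] at hcv
  have hx' : h x ≤ b := hx
  have h1 : ε ≤ l * |b - a| := by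
    have := mul_le_mul_of_nonneg_left hx₀ (sub_nonneg.2 hl1.le)
    have := mul_le_mul_of_nonneg_left hx' hl0.le
    have := mul_le_mul_of_nonneg_left (le_abs_self (b - a)) hl0.le
    linarith
  have h2 : l * ‖x - x₀‖ = R := by rw [hl, div_mul_cancel₀ _ hρ0.ne']
  have h3 : l * |b - a| / ε < 1 := by
    have := mul_lt_mul_of_pos_left hlt hl0
    rw [h2] at this
    have h4 : l * (1 + |b - a| / ε) < 1 := by
      by_contra! h5
      nlinarith
    have : l * |b - a| / ε = l * (|b - a| / ε) := by ring
    nlinarith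
  rw [div_lt_one hε] at h3
  linarith

/-! ### The graph Laplacian -/

namespace SimpleGraph

variable {V : Type*} [Fintype V] [DecidableEq V] (G : SimpleGraph V) [DecidableRel G.Adj]

theorem lapMatrix_mulVec_apply_eq_sum_sub (w : V → ℝ) (i : V) :
    (G.lapMatrix ℝ).mulVec w i = ∑ j ∈ G.neighborFinset i, (w i - w j) := by
  rw [lapMatrix_mulVec_apply, Finset.sum_sub_distrib, Finset.sum_const, nsmul_eq_mul,
    card_neighborFinset_eq_degree]

theorem sum_mul_sum_neighborFinset_sub (c w : V → ℝ) :
    ∑ i, c i * ∑ j ∈ G.neighborFinset i, (w i - w j) =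
      ∑ i, (∑ j ∈ G.neighborFinset i, (c i - c j)) * w i := by
  simp_rw [← lapMatrix_mulVec_apply_eq_sum_sub]
  change c ⬝ᵥ (G.lapMatrix ℝ).mulVec w = (G.lapMatrix ℝ).mulVec c ⬝ᵥ w
  rw [Matrix.dotProduct_mulVec, ← Matrix.mulVec_transpose, (G.isSymm_lapMatrix ℝ).eq]

theorem sum_sum_neighborFinset_sub (w : V → ℝ) :
    ∑ i, ∑ j ∈ G.neighborFinset i, (w i - w j) = 0 := by
  simpa using G.sum_mul_sum_neighborFinset_sub 1 w

variable {G} in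
/-- The range of a symmetric operator is the orthogonal complement of its kernel, which for the
Laplacian of a connected graph consists of the constant vectors. -/
theorem Connected.exists_lapMatrix_mulVec_eq (hG : G.Connected) {r : V → ℝ} (hr : ∑ i, r i = 0) :
    ∃ w, (G.lapMatrix ℝ).mulVec w = r := by
  have hT := Matrix.isSymmetric_toEuclideanLin_iff.2 (G.isHermitian_lapMatrix ℝ)
  have hmem : WithLp.toLp 2 r ∈ LinearMap.range (Matrix.toEuclideanLin (G.lapMatrix ℝ)) := by
    rw [← Submodule.orthogonal_orthogonal (LinearMap.range _), hT.orthogonal_range,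
      Submodule.mem_orthogonal]
    intro u hu
    have hu' : (G.lapMatrix ℝ).mulVec u.ofLp = 0 := by
      simpa [Matrix.toLpLin_apply] using hu
    obtain ⟨i₀⟩ := hG.nonempty
    have hcst : ∀ i, u.ofLp i = u.ofLp i₀ := fun i =>
      (lapMatrix_mulVec_eq_zero_iff_forall_reachable G).1 hu' i i₀ (hG.preconnected i i₀)
    simp [PiLp.inner_apply, hcst, ← Finset.sum_mul, hr]
  obtain ⟨w, hw⟩ := hmem
  refine ⟨w.ofLp, ?_⟩
  simpa [Matrix.toLpLin_apply] using congrArg WithLp.ofLp hw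

end SimpleGraph

/-! ### Infima of separable sums -/

/-- The infimum of a sum of functions of independent variables is the sum of their infima. -/
theorem IsGLB.sum_pi {ι : Type*} [Fintype ι] {X : ι → Type*} {g : ∀ i, X i → ℝ}
    {S : ∀ i, Set (X i)} {v : ι → ℝ} (h : ∀ i, IsGLB (g i '' S i) (v i)) :
    IsGLB ((fun x : ∀ i, X i => ∑ i, g i (x i)) '' {x | ∀ i, x i ∈ S i}) (∑ i, v i) := by
  refine ⟨?_, fun b hb => le_of_forall_pos_lt_add fun ε hε => ?_⟩
  · rintro - ⟨x, hx, rfl⟩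
    exact Finset.sum_le_sum fun i _ => (h i).1 ⟨x i, hx i, rfl⟩
  · have hδ : 0 < ε / (Fintype.card ι + 1) := by positivity
    have hex : ∀ i, ∃ x ∈ S i, g i x < v i + ε / (Fintype.card ι + 1) := fun i => by
      obtain ⟨-, ⟨x, hx, rfl⟩, -, hlt⟩ := (h i).exists_between (lt_add_of_pos_right (v i) hδ)
      exact ⟨x, hx, hlt⟩
    choose x hx hlt using hex
    calc b ≤ ∑ i, g i (x i) := hb ⟨x, hx, rfl⟩
      _ ≤ ∑ i, (v i + ε / (Fintype.card ι + 1)) := Finset.sum_le_sum fun i _ => (hlt i).le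
      _ = ∑ i, v i + ε * (Fintype.card ι / (Fintype.card ι + 1)) := by
        rw [Finset.sum_add_distrib, Finset.sum_const, nsmul_eq_mul, Finset.card_univ]
        ring
      _ < ∑ i, v i + ε := by
        have : (Fintype.card ι : ℝ) / (Fintype.card ι + 1) < 1 := by
          rw [div_lt_one (by positivity)]
          linarith
        nlinarith

namespace CoupledProblem

variable {N M : ℕ} (P : CoupledProblem N M) (G : SimpleGraph (Fin N)) [DecidableRel G.Adj]

/-! ### Feasibility -/

variable {P G} in
theorem feasible_of_localFeasible {y : AuxSpace N M} {x : P.Primal}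
    (hx : ∀ i, P.LocalFeasible G i y (x i)) : P.Feasible x := by
  intro m
  have h : ∑ i, P.localConstraint G i y m (x i) ≤ 0 := Finset.sum_nonpos fun i _ => hx i m
  have h0 := G.sum_sum_neighborFinset_sub fun j => y (j, m)
  simp only [localConstraint, Finset.sum_add_distrib] at h ⊢
  linarith

theorem reformulatedFeasible_iff {x : P.Primal} {y : AuxSpace N M} :
    P.ReformulatedFeasible G x y ↔ ∀ i, P.LocalFeasible G i y (x i) := by
  simp only [ReformulatedFeasible, LocalFeasible, localConstraint,
    SimpleGraph.lapMatrix_mulVec_apply_eq_sum_sub]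
  exact forall_comm

variable {P G} in
/-- The auxiliary variables can spread the slack of a coupling constraint evenly over the agents. -/
theorem exists_localFeasible_of_feasible (hG : G.Connected) {x : P.Primal} (hx : P.Feasible x) :
    ∃ y : AuxSpace N M, ∀ i, P.LocalFeasible G i y (x i) := by
  have hN : (0 : ℝ) < N := by
    obtain ⟨i⟩ := hG.nonempty
    exact_mod_cast i.pos
  let s : Fin N → Fin M → ℝ := fun i m => inner ℝ (P.a i m) (x i) + P.b i m
  have hex : ∀ m, ∃ w, (G.lapMatrix ℝ).mulVec w = fun i => (∑ j, s j m) / N - s i m := fun m => by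
    refine hG.exists_lapMatrix_mulVec_eq ?_
    rw [Finset.sum_sub_distrib, Finset.sum_const, Finset.card_univ, Fintype.card_fin, nsmul_eq_mul,
      mul_div_cancel₀ _ hN.ne', sub_self]
  choose w hw using hex
  refine ⟨WithLp.toLp 2 fun q => w q.2 q.1, fun i m => ?_⟩
  have h1 := congrFun (hw m) i
  rw [SimpleGraph.lapMatrix_mulVec_apply_eq_sum_sub] at h1
  have h2 : (∑ j, s j m) / N ≤ 0 := div_nonpos_of_nonpos_of_nonneg (hx m) hN.le
  simp only [localConstraint, h1]
  simp only [s] at h2 ⊢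
  linarith

theorem isClosed_setOf_feasible : IsClosed {x | P.Feasible x} := by
  simp only [Feasible, ofPred_forall]
  exact isClosed_iInter fun m => isClosed_le (by fun_prop) continuous_const

theorem continuous_localConstraint (i : Fin N) (m : Fin M) :
    Continuous fun q : AuxSpace N M × P.Local i => P.localConstraint G i q.1 m q.2 := by
  unfold localConstraint
  fun_prop

theorem continuous_cost (hconv : ∀ i, ConvexOn ℝ univ (P.f i)) : Continuous P.cost :=
  continuous_finsetSum _ fun i _ =>
    (hconv i).locallyLipschitz.continuous.comp (continuous_apply i)

/-! ### The value function -/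

/-- The optimal value of the local problem of agent `i`, as a function of the auxiliary variables.
It is a genuine infimum as soon as the problem is feasible and bounded below, see
`isGLB_localValue`. -/
noncomputable def localValue (i : Fin N) (y : AuxSpace N M) : ℝ :=
  sInf (P.f i '' {x | P.LocalFeasible G i y x})

/-- The optimal value of the reformulated problem for fixed auxiliary variables. -/
noncomputable def value (y : AuxSpace N M) : ℝ := ∑ i, P.localValue G i y

variable {P G} {p : ℝ}

theorem LocalSlater.exists_localFeasible (hs : P.LocalSlater G) (y : AuxSpace N M) (i : Fin N) :
    ∃ x, P.LocalFeasible G i y x :=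
  (hs y i).imp fun _ hx m => (hx m).le

/-- A local problem is bounded below, since combining its feasible points with fixed feasible points
of the other local problems gives feasible points of the coupled problem. -/
theorem isGLB_localValue (hp : P.IsOptimalValue p) (hs : P.LocalSlater G) (i : Fin N)
    (y : AuxSpace N M) :
    IsGLB (P.f i '' {x | P.LocalFeasible G i y x}) (P.localValue G i y) := by
  refine isGLB_csInf (Set.Nonempty.image _ (hs.exists_localFeasible y i)) ?_
  choose x₀ hx₀ using hs.exists_localFeasible y
  refine ⟨p - ∑ j ∈ Finset.univ.erase i, P.f j (x₀ j), ?_⟩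
  rintro - ⟨x, hx, rfl⟩
  have hfeas : P.Feasible (Function.update x₀ i x) := feasible_of_localFeasible (y := y) fun j => by
    rcases eq_or_ne j i with rfl | hj
    · simpa using hx
    · simpa [hj] using hx₀ j
  have h := hp.1 ⟨_, hfeas, rfl⟩
  rw [cost, ← Finset.add_sum_erase _ _ (Finset.mem_univ i), Function.update_self,
    Finset.sum_congr rfl (g := fun j => P.f j (x₀ j)) fun j hj => by
      rw [Function.update_of_ne (Finset.ne_of_mem_erase hj)]] at h
  linarith

theorem isGLB_value (hp : P.IsOptimalValue p) (hs : P.LocalSlater G) (y : AuxSpace N M) :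
    IsGLB (P.cost '' {x | P.ReformulatedFeasible G x y}) (P.value G y) := by
  simp only [reformulatedFeasible_iff]
  exact IsGLB.sum_pi fun i => isGLB_localValue hp hs i y

theorem value_le_cost (hp : P.IsOptimalValue p) (hs : P.LocalSlater G) {x : P.Primal}
    {y : AuxSpace N M} (hx : ∀ i, P.LocalFeasible G i y (x i)) : P.value G y ≤ P.cost x :=
  (isGLB_value hp hs y).1 ⟨x, (P.reformulatedFeasible_iff G).2 hx, rfl⟩

/-- The coupled and the reformulated problem have the same optimal value. -/
theorem isGLB_range_value (hG : G.Connected) (hp : P.IsOptimalValue p) (hs : P.LocalSlater G) :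
    IsGLB (range (P.value G)) p := by
  constructor
  · rintro - ⟨y, rfl⟩
    refine (isGLB_value hp hs y).2 ?_
    rintro - ⟨x, hx, rfl⟩
    exact hp.1 ⟨x, feasible_of_localFeasible ((P.reformulatedFeasible_iff G).1 hx), rfl⟩
  · refine fun b hb => hp.2 ?_
    rintro - ⟨x, hx, rfl⟩
    obtain ⟨y, hy⟩ := exists_localFeasible_of_feasible hG hx
    exact (hb ⟨y, rfl⟩).trans (value_le_cost hp hs hy)

theorem convexOn_localValue (hconv : ∀ i, ConvexOn ℝ univ (P.f i)) (hp : P.IsOptimalValue p)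
    (hs : P.LocalSlater G) (i : Fin N) : ConvexOn ℝ univ (P.localValue G i) := by
  refine ⟨convex_univ, fun y₁ _ y₂ _ s t hs0 ht0 hst => ?_⟩
  have key : ∀ x₁, P.LocalFeasible G i y₁ x₁ → ∀ x₂, P.LocalFeasible G i y₂ x₂ →
      P.localValue G i (s • y₁ + t • y₂) ≤ s * P.f i x₁ + t * P.f i x₂ := by
    intro x₁ h₁ x₂ h₂
    refine ((isGLB_localValue hp hs i _).1 ⟨s • x₁ + t • x₂, fun m => ?_, rfl⟩).trans
      ((hconv i).2 (mem_univ x₁) (mem_univ x₂) hs0 ht0 hst)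
    have e : P.localConstraint G i (s • y₁ + t • y₂) m (s • x₁ + t • x₂) =
        s * P.localConstraint G i y₁ m x₁ + t * P.localConstraint G i y₂ m x₂ := by
      have e1 : ∑ j ∈ G.neighborFinset i, ((s • y₁ + t • y₂) (i, m) - (s • y₁ + t • y₂) (j, m)) =
          s * ∑ j ∈ G.neighborFinset i, (y₁ (i, m) - y₁ (j, m)) +
          t * ∑ j ∈ G.neighborFinset i, (y₂ (i, m) - y₂ (j, m)) := by
        rw [Finset.mul_sum, Finset.mul_sum, ← Finset.sum_add_distrib]
        refine Finset.sum_congr rfl fun j _ => ?_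
        simp only [PiLp.add_apply, PiLp.smul_apply, smul_eq_mul]
        ring
      simp only [localConstraint, e1, inner_add_right, real_inner_smul_right]
      linear_combination -P.b i m * hst
    rw [e]
    exact add_nonpos (mul_nonpos_of_nonneg_of_nonpos hs0 (h₁ m))
      (mul_nonpos_of_nonneg_of_nonpos ht0 (h₂ m))
  refine le_of_forall_pos_le_add fun ε hε => ?_
  have hlt : ∀ y, ∃ x, P.LocalFeasible G i y x ∧ P.f i x < P.localValue G i y + ε := fun y => by
    obtain ⟨-, ⟨x, hx, rfl⟩, -, h⟩ :=
      (isGLB_localValue hp hs i y).exists_between (lt_add_of_pos_right _ hε)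
    exact ⟨x, hx, h⟩
  obtain ⟨x₁, h₁, l₁⟩ := hlt y₁
  obtain ⟨x₂, h₂, l₂⟩ := hlt y₂
  calc P.localValue G i (s • y₁ + t • y₂) ≤ s * P.f i x₁ + t * P.f i x₂ := key x₁ h₁ x₂ h₂
    _ ≤ s * (P.localValue G i y₁ + ε) + t * (P.localValue G i y₂ + ε) := by gcongr
    _ = s • P.localValue G i y₁ + t • P.localValue G i y₂ + ε := by
      simp only [smul_eq_mul]
      linear_combination ε * hst

theorem locallyLipschitz_value (hconv : ∀ i, ConvexOn ℝ univ (P.f i)) (hp : P.IsOptimalValue p)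
    (hs : P.LocalSlater G) : LocallyLipschitz (P.value G) := by
  refine ConvexOn.locallyLipschitz ?_
  have h : ∀ S : Finset (Fin N), ConvexOn ℝ univ fun y => ∑ i ∈ S, P.localValue G i y := fun S => by
    induction S using Finset.induction_on with
    | empty => simpa using convexOn_const 0 convex_univ
    | insert i S hi ih =>
      simp only [Finset.sum_insert hi]
      exact (convexOn_localValue hconv hp hs i).add ih
  exact h _

theorem IsLocalOptimal.f_eq_localValue (hp : P.IsOptimalValue p) (hs : P.LocalSlater G) {i : Fin N}
    {y : AuxSpace N M} {x : P.Local i} (hx : P.IsLocalOptimal G i y x) :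
    P.f i x = P.localValue G i y :=
  have h : IsLeast (P.f i '' {x | P.LocalFeasible G i y x}) (P.f i x) :=
    ⟨⟨x, hx.1, rfl⟩, by rintro - ⟨x', hx', rfl⟩; exact hx.2 x' hx'⟩
  h.isGLB.unique (isGLB_localValue hp hs i y)

theorem cost_eq_value (hp : P.IsOptimalValue p) (hs : P.LocalSlater G) {y : AuxSpace N M}
    {x : P.Primal} (hx : ∀ i, P.IsLocalOptimal G i y (x i)) : P.cost x = P.value G y :=
  Finset.sum_congr rfl fun i _ => (hx i).f_eq_localValue hp hs

/-! ### Optimal auxiliary variables -/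

theorem valueOptimalAux_eq (hp : P.IsOptimalValue p) (hs : P.LocalSlater G) :
    P.valueOptimalAux G = {y | ∀ y', P.value G y ≤ P.value G y'} := by
  ext y
  constructor
  · rintro ⟨v, hv, hle⟩ y'
    rw [(isGLB_value hp hs y).unique hv]
    refine (isGLB_value hp hs y').2 ?_
    rintro - ⟨x', hx', rfl⟩
    exact hle x' y' hx'
  · exact fun hy => ⟨_, isGLB_value hp hs y, fun x' y' hx' =>
      (hy y').trans ((isGLB_value hp hs y').1 ⟨x', hx', rfl⟩)⟩

theorem optimalAux_eq (hp : P.IsOptimalValue p) (hs : P.LocalSlater G)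
    (hatt : ∀ w i, ∃ x, P.IsLocalOptimal G i w x) :
    P.optimalAux G = {y | ∀ y', P.value G y ≤ P.value G y'} := by
  ext y
  constructor
  · rintro ⟨x, hx, hle⟩ y'
    refine ((isGLB_value hp hs y).1 ⟨x, hx, rfl⟩).trans ((isGLB_value hp hs y').2 ?_)
    rintro - ⟨x', hx', rfl⟩
    exact hle x' y' hx'
  · intro hy
    choose x hx using hatt y
    refine ⟨x, (P.reformulatedFeasible_iff G).2 fun i => (hx i).1, fun x' y' hx' => ?_⟩
    rw [cost_eq_value hp hs hx]
    exact (hy y').trans ((isGLB_value hp hs y').1 ⟨x', hx', rfl⟩)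

theorem IsOptimal.exists_forall_value_le (hG : G.Connected) (hp : P.IsOptimalValue p)
    (hs : P.LocalSlater G) {x : P.Primal} (hx : P.IsOptimal x) :
    ∃ y, ∀ y', P.value G y ≤ P.value G y' := by
  obtain ⟨y, hy⟩ := exists_localFeasible_of_feasible hG hx.1
  refine ⟨y, fun y' => (value_le_cost hp hs hy).trans ?_⟩
  have hxp : P.cost x ≤ p := hp.2 (by rintro - ⟨x', hx', rfl⟩; exact hx.2 x' hx')
  exact hxp.trans ((isGLB_range_value hG hp hs).1 ⟨y', rfl⟩)

/-! ### Lagrange multipliers are subgradients -/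

/-- Weak duality at `w`, combined with strong duality at `y`. -/
theorem IsLagrangeMultiplier.localValue_add_le (hp : P.IsOptimalValue p) (hs : P.LocalSlater G)
    {i : Fin N} {y : AuxSpace N M} {c : Fin M → ℝ} (hc : P.IsLagrangeMultiplier G i y c)
    (w : AuxSpace N M) :
    P.localValue G i y +
      ∑ m, c m * ∑ j ∈ G.neighborFinset i, ((w - y) (i, m) - (w - y) (j, m)) ≤
        P.localValue G i w := by
  obtain ⟨hc0, v, hv, hL⟩ := hc
  rw [(isGLB_localValue hp hs i y).unique hv]
  refine (isGLB_localValue hp hs i w).2 ?_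
  rintro - ⟨x, hx, rfl⟩
  have h1 := hL.1 ⟨x, rfl⟩
  have h2 : ∑ m, c m * P.localConstraint G i w m x ≤ 0 :=
    Finset.sum_nonpos fun m _ => mul_nonpos_of_nonneg_of_nonpos (hc0 m) (hx m)
  have h3 : ∑ m, c m * P.localConstraint G i w m x = ∑ m, c m * P.localConstraint G i y m x +
      ∑ m, c m * ∑ j ∈ G.neighborFinset i, ((w - y) (i, m) - (w - y) (j, m)) := by
    rw [← Finset.sum_add_distrib]
    refine Finset.sum_congr rfl fun m _ => ?_
    simp only [localConstraint, PiLp.sub_apply, Finset.sum_sub_distrib]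
    ring
  simp only at h1
  linarith

/-- The multipliers `c` of the local problems at `y` yield the subgradient `L c` of the value
function, because the Laplacian is symmetric. -/
theorem value_add_inner_le (hp : P.IsOptimalValue p) (hs : P.LocalSlater G) {y : AuxSpace N M}
    {c : Fin N → Fin M → ℝ} (hc : ∀ i, P.IsLagrangeMultiplier G i y (c i)) (w : AuxSpace N M) :
    P.value G y + inner ℝ (-updateLaw G 1 c) (w - y) ≤ P.value G w := by
  have h : ∑ i, (P.localValue G i y +
      ∑ m, c i m * ∑ j ∈ G.neighborFinset i, ((w - y) (i, m) - (w - y) (j, m))) ≤ P.value G w :=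
    Finset.sum_le_sum fun i _ => (hc i).localValue_add_le hp hs w
  rw [Finset.sum_add_distrib, Finset.sum_comm] at h
  refine le_of_eq_of_le (congrArg (P.value G y + ·) ?_) h
  rw [PiLp.inner_apply, Fintype.sum_prod_type_right]
  refine Finset.sum_congr rfl fun m _ => ?_
  rw [G.sum_mul_sum_neighborFinset_sub (fun i => c i m) fun i => (w - y) (i, m)]
  refine Finset.sum_congr rfl fun i _ => ?_
  simp [updateLaw, mul_comm]

theorem IsCaratheodorySolution.isSubgradientFlow (hp : P.IsOptimalValue p) (hs : P.LocalSlater G)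
    {k₀ : ℝ} {y : ℝ → AuxSpace N M} (hy : P.IsCaratheodorySolution G k₀ y) :
    IsSubgradientFlow (P.value G) k₀ y := by
  refine ⟨hy.1, hy.2.mono ?_⟩
  rintro t ⟨c, hc, hd⟩
  refine ⟨-updateLaw G 1 c, value_add_inner_le hp hs hc, ?_⟩
  have e : -(k₀ • -updateLaw G 1 c) = updateLaw G k₀ c := by
    ext q
    simp [updateLaw]
    ring
  rwa [e]

/-! ### Solutions of the local problems along the flow -/

theorem IsLocalOptimal.of_tendsto (hconv : ∀ i, ConvexOn ℝ univ (P.f i)) (hp : P.IsOptimalValue p)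
    (hs : P.LocalSlater G) {ι : Type*} {l : Filter ι} [l.NeBot] {i : Fin N} {y : ι → AuxSpace N M}
    {x : ι → P.Local i} {w : AuxSpace N M} {u : P.Local i} (hy : Tendsto y l (𝓝 w))
    (hx : Tendsto x l (𝓝 u)) (h : ∀ᶠ t in l, P.IsLocalOptimal G i (y t) (x t)) :
    P.IsLocalOptimal G i w u := by
  have hf : P.f i u = P.localValue G i w := by
    refine tendsto_nhds_unique (((hconv i).locallyLipschitz.continuous.tendsto u).comp hx)
      ((((convexOn_localValue hconv hp hs i).locallyLipschitz.continuous.tendsto w).comp hy).congr'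
        ?_)
    filter_upwards [h] with t ht using (ht.f_eq_localValue hp hs).symm
  refine ⟨fun m => ?_, fun x' hx' => hf.le.trans ((isGLB_localValue hp hs i w).1 ⟨x', hx', rfl⟩)⟩
  refine le_of_tendsto (((P.continuous_localConstraint G i m).tendsto (w, u)).comp
    (hy.prodMk_nhds hx)) ?_
  filter_upwards [h] with t ht using ht.1 m

/-- If some local problem of agent `i` has a nonempty bounded set of solutions, then all sets given
by upper bounds on the cost and on the constraint functions are bounded: these sets are contained in
sublevel sets of one convex function, whose lowest sublevel set is that set of solutions. -/
theorem IsLocalOptimal.isBounded_sublevel (hconv : ∀ i, ConvexOn ℝ univ (P.f i)) {i : Fin N}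
    {w : AuxSpace N M} {u : P.Local i} (hu : P.IsLocalOptimal G i w u)
    (hb : Bornology.IsBounded {x | P.IsLocalOptimal G i w x}) (α : ℝ) (β : Fin M → ℝ) :
    Bornology.IsBounded {x | P.f i x ≤ α ∧ ∀ m, P.localConstraint G i w m x ≤ β m} := by
  -- `h ≥ 0`, with equality exactly at the solutions of the local problem at `w`
  let h : P.Local i → ℝ := fun x =>
    max (P.f i x - P.f i u) 0 + ∑ m, max (P.localConstraint G i w m x) 0
  have hcv : ConvexOn ℝ univ h := by
    have hc0 : ConvexOn ℝ univ fun _ : P.Local i => (0 : ℝ) := convexOn_const 0 convex_univ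
    have hlc : ∀ m, ConvexOn ℝ univ fun x => max (P.localConstraint G i w m x) 0 := fun m => by
      refine ConvexOn.sup (f := P.localConstraint G i w m) ?_ hc0
      exact ((innerSL ℝ (P.a i m)).toLinearMap.convexOn convex_univ).add_const _ |>.add_const _
    have hsum : ∀ S : Finset (Fin M),
        ConvexOn ℝ univ fun x => ∑ m ∈ S, max (P.localConstraint G i w m x) 0 := fun S => by
      induction S using Finset.induction_on with
      | empty => simpa using hc0
      | insert m S hm ih =>
        simp only [Finset.sum_insert hm]
        exact (hlc m).add ih
    refine ConvexOn.add (ConvexOn.sup (f := fun x => P.f i x - P.f i u) ?_ hc0) (hsum _)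
    simpa only [sub_eq_add_neg] using! (hconv i).add_const (-P.f i u)
  have hu0 : h u ≤ 0 := by
    have : ∀ m, max (P.localConstraint G i w m u) 0 = 0 := fun m => max_eq_right (hu.1 m)
    simp [h, this]
  have hsub : {x | h x ≤ 0} ⊆ {x | P.IsLocalOptimal G i w x} := by
    intro x hx
    have hx' : max (P.f i x - P.f i u) 0 + ∑ m, max (P.localConstraint G i w m x) 0 ≤ 0 := hx
    have h1 : 0 ≤ max (P.f i x - P.f i u) 0 := le_max_right _ _
    have h2 : ∀ m, 0 ≤ max (P.localConstraint G i w m x) 0 := fun m => le_max_right _ _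
    have h3 := Finset.sum_nonneg fun m (_ : m ∈ Finset.univ) => h2 m
    have hfx : P.f i x ≤ P.f i u := by linarith [le_max_left (P.f i x - P.f i u) 0]
    refine ⟨fun m => ?_, fun x' hx' => hfx.trans (hu.2 x' hx')⟩
    have h4 := Finset.single_le_sum (fun m _ => h2 m) (Finset.mem_univ m)
    linarith [le_max_left (P.localConstraint G i w m x) 0]
  refine (hcv.isBounded_sublevel hu0 (hb.subset hsub)
    (max (α - P.f i u) 0 + ∑ m, max (β m) 0)).subset ?_
  rintro x ⟨hx, hxm⟩
  exact add_le_add (max_le_max (by linarith) le_rfl)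
    (Finset.sum_le_sum fun m _ => max_le_max (hxm m) le_rfl)

/-- Solutions of the local problems stay bounded as long as the auxiliary variables converge. A
priori the local problems at the limit need not have a solution, so the bound is taken from the
local problems at time `0`. -/
theorem exists_isCompact_eventually_mem (hconv : ∀ i, ConvexOn ℝ univ (P.f i))
    (hp : P.IsOptimalValue p) (hs : P.LocalSlater G)
    (hb : ∀ w i, Bornology.IsBounded {u | P.IsLocalOptimal G i w u}) {y : ℝ → AuxSpace N M}
    {w : AuxSpace N M} (hy : Tendsto y atTop (𝓝 w)) {x : ℝ → P.Primal}
    (hx : ∀ t, 0 ≤ t → ∀ i, P.IsLocalOptimal G i (y t) (x t i)) :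
    ∃ K, IsCompact K ∧ ∀ᶠ t in atTop, x t ∈ K := by
  let S : ∀ i, Set (P.Local i) := fun i => {u | P.f i u ≤ P.localValue G i w + 1 ∧
    ∀ m, P.localConstraint G i (y 0) m u ≤
      ∑ j ∈ G.neighborFinset i, (y 0 (i, m) - y 0 (j, m)) -
        ∑ j ∈ G.neighborFinset i, (w (i, m) - w (j, m)) + 1}
  have hS : Bornology.IsBounded (univ.pi S) := Bornology.IsBounded.pi fun i =>
    (hx 0 le_rfl i).isBounded_sublevel hconv (hb _ i) _ _
  refine ⟨_, hS.isCompact_closure, ?_⟩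
  have h1 : ∀ᶠ t in atTop, ∀ i, P.localValue G i (y t) < P.localValue G i w + 1 :=
    eventually_all.2 fun i =>
      (((convexOn_localValue hconv hp hs i).locallyLipschitz.continuous.tendsto w).comp
        hy).eventually_lt_const (lt_add_one _)
  have h2 : ∀ᶠ t in atTop, ∀ i m, ∑ j ∈ G.neighborFinset i, (w (i, m) - w (j, m)) - 1 <
      ∑ j ∈ G.neighborFinset i, (y t (i, m) - y t (j, m)) :=
    eventually_all.2 fun i => eventually_all.2 fun m => by
      have hc : Continuous fun v : AuxSpace N M =>
        ∑ j ∈ G.neighborFinset i, (v (i, m) - v (j, m)) := by fun_prop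
      exact ((hc.tendsto w).comp hy).eventually_const_lt (sub_one_lt _)
  filter_upwards [h1, h2, eventually_ge_atTop 0] with t ht1 ht2 ht
  refine subset_closure fun i _ => ⟨?_, fun m => ?_⟩
  · rw [(hx t ht i).f_eq_localValue hp hs]
    exact (ht1 i).le
  · have h3 := (hx t ht i).1 m
    have h4 := ht2 i m
    simp only [localConstraint] at h3 ⊢
    linarith

end CoupledProblem

/-! ### Convergence of the distributed algorithm -/


theorem theorem1 {N M : ℕ} (P : CoupledProblem N M)
    (G : SimpleGraph (Fin N)) [DecidableRel G.Adj] (hG : G.Connected)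
    (hconv : ∀ i, ConvexOn ℝ univ (P.f i))
    (p : ℝ) (hp : P.IsOptimalValue p)
    (hslater : P.LocalSlater G)
    (k₀ : ℝ) (hk₀ : 0 < k₀)
    (y : ℝ → AuxSpace N M) (hy : P.IsCaratheodorySolution G k₀ y) :
    -- uniqueness of the solution for a given initial value
    (∀ z : ℝ → AuxSpace N M, P.IsCaratheodorySolution G k₀ z → z 0 = y 0 →
      ∀ t, 0 ≤ t → z t = y t) ∧
    -- convergence to the set of optimal `y`, in terms of optimal values
    ((P.valueOptimalAux G).Nonempty →
      Tendsto (fun t => Metric.infDist (y t) (P.valueOptimalAux G)) atTop (𝓝 0)) ∧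
    -- convergence to the set of optimal `y`, provided that the minima are attained
    ((∃ x, P.IsOptimal x) → (∀ w i, ∃ x, P.IsLocalOptimal G i w x) →
      (P.optimalAux G).Nonempty ∧
        Tendsto (fun t => Metric.infDist (y t) (P.optimalAux G)) atTop (𝓝 0)) ∧
    -- asymptotic optimality of the solutions of the local problems
    (∀ x : ℝ → P.Primal, (∀ t, 0 ≤ t → ∀ i, P.IsLocalOptimal G i (y t) (x t i)) →
      Tendsto (fun t => P.cost (x t)) atTop (𝓝 p) ∧
      (∀ x₀, MapClusterPt x₀ atTop x → P.IsOptimal x₀) ∧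
      ((∃ x₀, P.IsOptimal x₀) →
        ((∀ w i, Bornology.IsBounded {u | P.IsLocalOptimal G i w u}) →
          Tendsto (fun t => Metric.infDist (x t) {x₀ | P.IsOptimal x₀}) atTop (𝓝 0)) ∧
        ((∀ w i, {u | P.IsLocalOptimal G i w u}.Subsingleton) →
          ∃ x₀, P.IsOptimal x₀ ∧ Tendsto x atTop (𝓝 x₀)))) ∧
    -- the coupling constraints hold at every time
    (∀ t, 0 ≤ t → ∀ x : P.Primal, (∀ i, P.LocalFeasible G i (y t) (x i)) → P.Feasible x) := by
  have hflow := hy.isSubgradientFlow hp hslater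
  have hlip := CoupledProblem.locallyLipschitz_value hconv hp hslater
  have hconvg : ∀ w, (∀ v, P.value G w ≤ P.value G v) →
      Tendsto (fun t => Metric.infDist (y t) {w | ∀ v, P.value G w ≤ P.value G v}) atTop (𝓝 0) := by
    intro w hw
    obtain ⟨w', hw', hlim⟩ := hflow.exists_tendsto hk₀ hlip hw
    exact squeeze_zero (fun _ => Metric.infDist_nonneg)
      (fun t => Metric.infDist_le_dist_of_mem (x := y t) hw') (tendsto_iff_dist_tendsto_zero.1 hlim)
  refine ⟨fun z hz h0 t ht => ?_, ?_, ?_, ?_,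
    fun t _ x hx => CoupledProblem.feasible_of_localFeasible hx⟩
  · exact (hz.isSubgradientFlow hp hslater).eq_of_eq_zero hk₀.le hflow h0 ht
  · rw [CoupledProblem.valueOptimalAux_eq hp hslater]
    rintro ⟨w, hw⟩
    exact hconvg w hw
  · rintro ⟨x, hx⟩ hatt
    obtain ⟨w, hw⟩ := hx.exists_forall_value_le hG hp hslater
    rw [CoupledProblem.optimalAux_eq hp hslater hatt]
    exact ⟨⟨w, hw⟩, hconvg w hw⟩
  · intro x hx
    have hcost : Tendsto (fun t => P.cost (x t)) atTop (𝓝 p) := by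
      refine (hflow.tendsto_comp hk₀ hlip (CoupledProblem.isGLB_range_value hG hp hslater)).congr' ?_
      filter_upwards [eventually_ge_atTop 0] with t ht
      exact (CoupledProblem.cost_eq_value hp hslater (hx t ht)).symm
    have hcluster : ∀ x₀, MapClusterPt x₀ atTop x → P.IsOptimal x₀ := by
      intro x₀ hx₀
      have hval : P.cost x₀ = p :=
        (hx₀.continuousAt_comp (P.continuous_cost hconv).continuousAt).eq_of_tendsto hcost
      refine ⟨P.isClosed_setOf_feasible.mem_of_mapClusterPt hx₀ ?_,
        fun x' hx' => hval.le.trans (hp.1 ⟨x', hx', rfl⟩)⟩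
      filter_upwards [eventually_ge_atTop 0] with t ht
      exact CoupledProblem.feasible_of_localFeasible fun i => (hx t ht i).1
    refine ⟨hcost, hcluster, ?_⟩
    rintro ⟨x₁, hx₁⟩
    obtain ⟨w₁, hw₁⟩ := hx₁.exists_forall_value_le hG hp hslater
    obtain ⟨w, -, hw⟩ := hflow.exists_tendsto hk₀ hlip hw₁
    refine ⟨fun hb => ?_, fun hsub => ?_⟩
    · obtain ⟨K, hK, hxK⟩ :=
        CoupledProblem.exists_isCompact_eventually_mem hconv hp hslater hb hw hx
      exact Metric.tendsto_infDist_of_mapClusterPt hK hxK hcluster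
    · obtain ⟨K, hK, hxK⟩ := CoupledProblem.exists_isCompact_eventually_mem hconv hp hslater
        (fun w i => (hsub w i).finite.isBounded) hw hx
      -- cluster points solve the local problems at the limit `w`, which determines them
      have hloc : ∀ x₀, MapClusterPt x₀ atTop x → ∀ i, P.IsLocalOptimal G i w (x₀ i) := by
        intro x₀ hx₀ i
        obtain ⟨s, hxs, hs⟩ := hx₀.exists_seq_tendsto
        refine .of_tendsto hconv hp hslater (hw.comp hs)
          (((continuous_apply i).tendsto x₀).comp hxs) ?_
        filter_upwards [hs.eventually_ge_atTop 0] with n hn using hx _ hn i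
      obtain ⟨x₀, -, hx₀⟩ := hK.exists_mapClusterPt (f := atTop) (u := x) (le_principal_iff.2 hxK)
      refine ⟨x₀, hcluster x₀ hx₀, hK.tendsto_nhds_of_unique_mapClusterPt hxK fun x' _ hx' => ?_⟩
      exact funext fun i => hsub w i (hloc x' hx' i) (hloc x₀ hx₀ i)
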